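/- Let $1\le m\le n$. An $m\times n$ Latin rectangle is a matrix with $m$ rows and $n$ columns and entries in $[n]=\{1,\dots,n\}$ in which no entry is repeated in a row or in a column; it is reduced if its first row is $1\,2\,\dots\,n$. Let $K(m,n)$ be the number of reduced $m\times n$ Latin rectangles. Indices. Consider the sequences $\alpha=(\alpha_m,\dots,\alpha_1)$ of integers with $0\le\alpha_j\le j-1$ for all $j\in[m]$; there are $m!$ of them. If $\alpha_i>0$, say that the entry at position $i$ covers the entry at position $\alpha_i$. For $h\in[m]$, if $\alpha_h=0$ let the component $\sigma_h(\alpha)$ be the set of all pairs $(j,\alpha_j)$ such that iterated covering (zero or more steps) leads from position $j$ to position $h$; if $\alpha_h\neq 0$ let $\sigma_h(\alpha)=\emptyset$. Let $\zeta(\alpha)$ be the number of $j$ with $\alpha_j=0$. For $l\in[m]$, the letter $Z_l$ ranges over all the nonempty sets of the form $\sigma_l(\alpha)$; for $l=0$ put $\sigma_0(\alpha)=\emptyset$ for all $\alpha$, and $Z_0$ takes the only value $\emptyset$. Variables. Let $R=\{r_\alpha\}$ and $C=\{c_\beta\}$ be two families of variables indexed by these sequences ($2\cdot m!$ variables in all),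 each ranging over the nonnegative integers. Put $Q(Z_l)=\{r_\alpha:\sigma_l(\alpha)=Z_l\}$, $\tilde Q(Z_l)=\{c_\beta:\sigma_l(\beta)=Z_l\}$, $q(Z_l)=\sum Q(Z_l)$ (so $q(Z_0)=\sum R$), and $W=\{r_\alpha:\zeta(\alpha)\text{ odd}\}$. Here, for a family $X$, $\sum X$, $\prod X!$ denote the sum of its members and the product of their factorials, and $\binom{N}{X}$ is $N!/\prod X!$ if $\sum X=N$ and $0$ otherwise. The condition $\sum\tilde Q(Z_l)=q(Z_l)$ below a summation sign is imposed for all $l\in[m]$ and all $Z_l$. For an integer $q\ge 0$ put $(-q)!^{\backprime}=(-q)(-q+1)\cdots(-1)$ ($q$ factors). Then $$K(m,n)=\sum_{R}\ \sum_{\substack{C\\ \sum\tilde Q(Z_l)=q(Z_l)}}(-1)^{nm+\sum_{l=1}^m\sum_{Z_l}q(Z_l)}\binom nR\prod_{l=2}^m\prod_{Z_l}q(Z_l)!\ \prod_{Z_1}\binom{q(Z_1)}{\tilde Q(Z_1)}$$ $$=\sum_{\substack{R\\ \sum R=n}}\ \sum_{\substack{C\\ \sum\tilde Q(Z_l)=q(Z_l)}}(-1)^{nm+\sum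 W}\,\frac{\prod_{l=0}^m\prod_{Z_l}q(Z_l)!}{\prod R!\,\prod C!}$$ $$=(-1)^{n(m-1)}\sum_{\substack{R\\ \sum R=n}}\ \sum_{\substack{C\\ \sum\tilde Q(Z_l)=q(Z_l)}}\frac{\prod_{l=0}^m\prod_{Z_l}(-q(Z_l))!^{\backprime}}{\prod R!\,\prod C!}$$ $$=(-1)^{nm}\sum_R\sum_C\binom nR\prod_{l=1}^m\prod_{Z_l}(-1)^{q(Z_l)}\binom{q(Z_l)}{\tilde Q(Z_l)}\cdot\prod_{\beta}(c_\beta!)^{\zeta(\beta)-1},$$ where in the last line the $C$ variables are unrestricted (in each of the sums only finitely many terms are nonzero). -/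

import Mathlib

open scoped Nat BigOperators

namespace LatinRect

/-- An `m × n` Latin rectangle: a matrix with `m` rows and `n` columns and entries in an `n`-set,
with no repetition in a row or in a column. -/
def IsLatinRectangle {m n : ℕ} (M : Matrix (Fin m) (Fin n) (Fin n)) : Prop :=
  (∀ i, Function.Injective fun j => M i j) ∧ (∀ j, Function.Injective fun i => M i j)

/-- The first row is the identical permutation `1 2 … n`. -/
def IsReduced {m n : ℕ} (M : Matrix (Fin m) (Fin n) (Fin n)) : Prop :=
  ∀ i : Fin m, (i : ℕ) = 0 → ∀ j, M i j = j

/-- `K(m,n)`, the number of reduced `m × n` Latin rectangles. -/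
noncomputable def K (m n : ℕ) : ℕ :=
  Nat.card {M : Matrix (Fin m) (Fin n) (Fin n) // IsLatinRectangle M ∧ IsReduced M}

/-- The index sequences `α_m … α_1` with `0 ≤ α_j ≤ j - 1`; positions are numbered from `1`. -/
abbrev Index (m : ℕ) : Type := (j : Finset.Icc 1 m) → Fin (j : ℕ)

/-- The entry at position `i` covers the entry at position `s` when `α_i = s`
(as `s ≥ 1`, an entry equal to `0` covers nothing). -/
def Covers {m : ℕ} (α : Index m) (i s : Finset.Icc 1 m) : Prop := (α i : ℕ) = (s : ℕ)

open Classical in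
/-- The component `Z_h` of `α`: if `α_h = 0`, the entries from which iterated covering leads to
position `h`, each recorded as the pair (position, value); empty if `α_h ≠ 0`.
For `h = 0` there is no position `h`, and the component is empty. -/
noncomputable def component {m : ℕ} (α : Index m) (h : ℕ) : Finset (ℕ × ℕ) :=
  (Finset.univ.filter fun j : Finset.Icc 1 m =>
    ∃ i : Finset.Icc 1 m, (i : ℕ) = h ∧ (α i : ℕ) = 0 ∧
      Relation.ReflTransGen (Covers α) j i).image
        fun j : Finset.Icc 1 m => ((j : ℕ), (α j : ℕ))

/-- `ζ(α)`, the number of entries of `α` equal to `0`. -/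
def zeta {m : ℕ} (α : Index m) : ℕ :=
  (Finset.univ.filter fun j : Finset.Icc 1 m => (α j : ℕ) = 0).card

/-- The possible values of `Z_l`: for `l ≥ 1` all the nonempty components `l` of index sequences,
for `l = 0` only `Z_0 = ∅`. -/
noncomputable def components (m l : ℕ) : Finset (Finset (ℕ × ℕ)) :=
  if l = 0 then {∅} else (Finset.univ.image fun α : Index m => component α l).erase ∅

/-- The index sequences whose component `l` is `Z`; the variables `r` with these indices form
`Q(Z)`, the variables `c` with these indices form `Q̃(Z)`. -/
noncomputable def Q (m l : ℕ) (Z : Finset (ℕ × ℕ)) : Finset (Index m) :=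
  Finset.univ.filter fun α => component α l = Z

/-- `q(Z_l) = ∑ Q(Z_l)`; applied to the variables `c` it is `∑ Q̃(Z_l)`. -/
noncomputable def q {m : ℕ} (x : Index m → ℕ) (l : ℕ) (Z : Finset (ℕ × ℕ)) : ℕ :=
  ∑ α ∈ Q m l Z, x α

/-- The restrictions `∑ Q̃(Z_l) = q(Z_l)` for all `l ∈ [m]` and all `Z_l`. -/
def Compatible {m : ℕ} (r c : Index m → ℕ) : Prop :=
  ∀ l ∈ Finset.Icc 1 m, ∀ Z ∈ components m l, q c l Z = q r l Z

/-- `∑ W`, where `W` consists of the variables `r_α` with `ζ(α)` odd. -/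
def sumW {m : ℕ} (r : Index m → ℕ) : ℕ :=
  ∑ α ∈ Finset.univ.filter (fun α : Index m => Odd (zeta α)), r α

/-- The multinomial coefficient of `N` over the family `(x_i)`, `i ∈ s`: equal to `N! / ∏ x_i!` if
`∑ x_i = N`, and to `0` otherwise. -/
def multinom {ι : Type} (N : ℕ) (s : Finset ι) (x : ι → ℕ) : ℕ :=
  if ∑ i ∈ s, x i = N then Nat.multinomial s x else 0

/-- The raising factorial `⟨x⟩_k = x (x + 1) ⋯ (x + k - 1)`. -/
def raising (x : ℤ) (k : ℕ) : ℤ := ∏ i ∈ Finset.range k, (x + (i : ℤ))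

/-- The raising factorial of `x` with `|x|` factors: `⟨n⟩_n` for `x = n ≥ 0`, and
`(-q)(-q + 1) ⋯ (-1)` for `x = -q ≤ 0`. -/
def raisingFactorial (x : ℤ) : ℤ := raising x x.natAbs

end LatinRect

/-!
A Latin rectangle is a family of permutations `π_j` of `[n]`, one for each row, such that in each
column `k` the map `j ↦ π_j k` is injective. Injectivity of a map `f` on `[m]` has the indicator
`∏_j (1 - ∑_{i < j} [f j = f i])`: if `f` is not injective, the factor of the first `j` that
repeats an earlier value is `1 - 1 = 0`. Expanding the product gives one term for each index
sequence `α`, with sign `(-1) ^ (m - ζ(α))`, which is the indicator that `f` is constant on the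
components of `α` (`indicator_injective`). Hence the number of Latin rectangles is a signed sum,
over all assignments `a` of index sequences to the columns, of the number of families `π` that are
constant in each column `k` along the components of `a k`.

Such a family induces an index sequence `b s` for each symbol `s`: its entry at `j` is that of the
column in which the row `j` has the symbol `s`. With `a` and `b` prescribed, `π` amounts to a
choice, for each position `l` and each component `Z` at `l`, of a bijection from the columns whose
label has the component `Z` at `l` to the symbols with that property (`bijective_toMatching`). So
there are `∏_l ∏_{Z_l} q(Z_l)!` families if `a` and `b` contain each component equally often, and
none otherwise (`card_isLinking`).

This number depends only on the multiplicities `r` and `c` of the index sequences in `a` and `b`,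
so that grouping by them brings in `n! / ∏ r!` and `n! / ∏ c!` (`sum_count`). The last `n!` cancels
against the choice of the first row (`reducedProdPermEquiv`), which gives `K_eq_sum_contribution`.
The four expressions are rewritings of that sum: each index sequence has exactly `ζ` nonempty
components (`prod_prod_components`), exactly one of them at position `1`
(`prod_components_one`).
-/

namespace LatinRect

/-! ### Components of index sequences -/

theorem exists_root {m : ℕ} (α : Index m) (j : Finset.Icc 1 m) :
    ∃ l : Finset.Icc 1 m, (α l : ℕ) = 0 ∧ Relation.ReflTransGen (Covers α) j l := by
  obtain ⟨j, hj⟩ := j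
  induction j using Nat.strong_induction_on with
  | _ j ih =>
    by_cases h : (α ⟨j, hj⟩ : ℕ) = 0
    · exact ⟨_, h, .refl⟩
    · have hlt : (α ⟨j, hj⟩ : ℕ) < j := (α ⟨j, hj⟩).isLt
      have hmem : (α ⟨j, hj⟩ : ℕ) ∈ Finset.Icc 1 m := by
        rw [Finset.mem_Icc] at hj ⊢
        omega
      obtain ⟨l, hl, hr⟩ := ih _ hlt hmem
      exact ⟨l, hl, .head (show Covers α ⟨j, hj⟩ ⟨_, hmem⟩ from rfl) hr⟩

/-- The position at which iterated covering, started at `j`, stops. -/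
noncomputable def root {m : ℕ} (α : Index m) (j : Finset.Icc 1 m) : Finset.Icc 1 m :=
  (exists_root α j).choose

theorem apply_root {m : ℕ} (α : Index m) (j : Finset.Icc 1 m) : (α (root α j) : ℕ) = 0 :=
  (exists_root α j).choose_spec.1

theorem reflTransGen_root {m : ℕ} (α : Index m) (j : Finset.Icc 1 m) :
    Relation.ReflTransGen (Covers α) j (root α j) :=
  (exists_root α j).choose_spec.2

theorem eq_of_reflTransGen {m : ℕ} {α : Index m} {l l' : Finset.Icc 1 m} (hl : (α l : ℕ) = 0)
    (h : Relation.ReflTransGen (Covers α) l l') : l = l' := by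
  rcases h.cases_head with h | ⟨x, hx, -⟩
  · exact h
  · have := (Finset.mem_Icc.1 x.2).1
    rw [Covers, hl] at hx
    omega

theorem root_eq {m : ℕ} {α : Index m} {j l : Finset.Icc 1 m} (hl : (α l : ℕ) = 0)
    (h : Relation.ReflTransGen (Covers α) j l) : root α j = l := by
  have hu : Relator.RightUnique (Covers α) := fun x y z hy hz => Subtype.ext (hy.symm.trans hz)
  rcases Relation.ReflTransGen.total_of_right_unique hu (reflTransGen_root α j) h with h' | h'
  · exact eq_of_reflTransGen (apply_root α j) h'
  · exact (eq_of_reflTransGen hl h').symm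

theorem root_eq_iff {m : ℕ} {α : Index m} {j l : Finset.Icc 1 m} :
    root α j = l ↔ (α l : ℕ) = 0 ∧ Relation.ReflTransGen (Covers α) j l :=
  ⟨fun h => h ▸ ⟨apply_root α j, reflTransGen_root α j⟩, fun h => root_eq h.1 h.2⟩

theorem root_of_covers {m : ℕ} {α : Index m} {j i : Finset.Icc 1 m} (h : Covers α j i) :
    root α j = root α i :=
  root_eq (apply_root α i) (.head h (reflTransGen_root α i))

theorem mem_component {m : ℕ} {α : Index m} {l : Finset.Icc 1 m} {p : ℕ × ℕ} :
    p ∈ component α l ↔ ∃ j : Finset.Icc 1 m, root α j = l ∧ ((j : ℕ), (α j : ℕ)) = p := by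
  simp only [component, Finset.mem_image, Finset.mem_filter, Finset.mem_univ, true_and,
    root_eq_iff]
  refine exists_congr fun j => and_congr_left fun _ => ⟨?_, fun h => ⟨l, rfl, h⟩⟩
  rintro ⟨i, hi, h⟩
  obtain rfl := Subtype.ext hi
  exact h

theorem component_ne_empty_iff {m : ℕ} {α : Index m} {l : Finset.Icc 1 m} :
    component α l ≠ ∅ ↔ (α l : ℕ) = 0 := by
  rw [← Finset.nonempty_iff_ne_empty]
  constructor
  · rintro ⟨p, hp⟩
    obtain ⟨j, rfl, -⟩ := mem_component.1 hp
    exact apply_root α j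
  · exact fun h => ⟨_, mem_component.2 ⟨l, root_eq h .refl, rfl⟩⟩

theorem component_mem_components_iff {m : ℕ} {α : Index m} {l : Finset.Icc 1 m} :
    component α l ∈ components m l ↔ (α l : ℕ) = 0 := by
  have h : (l : ℕ) ≠ 0 := by have := (Finset.mem_Icc.1 l.2).1; omega
  rw [components, if_neg h, Finset.mem_erase, component_ne_empty_iff]
  exact and_iff_left (Finset.mem_image_of_mem _ (Finset.mem_univ α))

/-- Two indices that share a component agree on it: the component stores the positions together
with their values, and it shows where iterated covering ends. -/
theorem eq_of_component_eq {m : ℕ} {α β : Index m} {j : Finset.Icc 1 m}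
    (h : component α (root α j) = component β (root α j)) :
    α j = β j ∧ root β j = root α j := by
  have hj : ((j : ℕ), (α j : ℕ)) ∈ component β (root α j) :=
    h ▸ mem_component.2 ⟨j, rfl, rfl⟩
  obtain ⟨i, hi, he⟩ := mem_component.1 hj
  obtain ⟨h1, h2⟩ := Prod.mk.inj he
  obtain rfl := Subtype.ext h1
  exact ⟨Fin.ext h2.symm, hi⟩

/-! ### Counting the rows with given column and symbol labels -/

/-- Rows `π` of a rectangle with column labels `a` and symbol labels `b`: in the column `k` the
symbols at positions linked by covering in `a k` are equal, and the symbol at position `j` of the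
column `k` carries the entry `a k j` in its own label. -/
def IsLinking {m n : ℕ} (a b : Fin n → Index m) (π : Finset.Icc 1 m → Equiv.Perm (Fin n)) :
    Prop :=
  (∀ k j i, Covers (a k) j i → π j k = π i k) ∧ ∀ k j, b (π j k) j = a k j

theorem apply_eq_apply_root {m n : ℕ} {a : Fin n → Index m}
    {π : Finset.Icc 1 m → Equiv.Perm (Fin n)}
    (h : ∀ k j i, Covers (a k) j i → π j k = π i k) (k : Fin n) (j : Finset.Icc 1 m) :
    π j k = π (root (a k) j) k := by
  have hr := reflTransGen_root (a k) j
  generalize root (a k) j = l at hr ⊢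
  induction hr with
  | refl => rfl
  | tail _ hc ih => exact ih.trans (h k _ _ hc)

theorem IsLinking.root_eq {m n : ℕ} {a b : Fin n → Index m}
    {π : Finset.Icc 1 m → Equiv.Perm (Fin n)} (h : IsLinking a b π) (k : Fin n)
    (j : Finset.Icc 1 m) : root (b (π j k)) j = root (a k) j := by
  refine LatinRect.root_eq ?_ ?_
  · rw [apply_eq_apply_root h.1 k j, h.2]
    exact apply_root (a k) j
  · have hr := reflTransGen_root (a k) j
    generalize root (a k) j = l at hr ⊢
    induction hr using Relation.ReflTransGen.head_induction_on with
    | refl => exact .refl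
    | @head j i hc _ ih =>
      refine .head (b := i) ?_ ?_
      · rw [Covers, h.2]
        exact hc
      · rw [h.1 k j i hc]
        exact ih

/-- In a linking, the symbol at the position `l` of a column has the same component at `l` as the
column. -/
theorem IsLinking.component_eq {m n : ℕ} {a b : Fin n → Index m}
    {π : Finset.Icc 1 m → Equiv.Perm (Fin n)} (h : IsLinking a b π) (k : Fin n)
    (l : Finset.Icc 1 m) : component (b (π l k)) l = component (a k) l := by
  ext p
  rw [mem_component, mem_component]
  constructor
  · rintro ⟨j, hj, rfl⟩
    -- the column in which the symbol `π l k` has position `j`; it turns out to be `k`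
    obtain ⟨k', hk'⟩ := (π j).surjective (π l k)
    have hr : root (a k') j = l := by rw [← h.root_eq k' j, hk', hj]
    have he : π l k' = π l k := by rw [← hk', apply_eq_apply_root h.1 k' j, hr]
    obtain rfl := (π l).injective he
    exact ⟨j, hr, by rw [← hk', h.2]⟩
  · rintro ⟨j, rfl, rfl⟩
    exact ⟨j, by rw [← apply_eq_apply_root h.1 k j, h.root_eq], by
      rw [← apply_eq_apply_root h.1 k j, h.2]⟩

/-- Families of bijections, one for each position `l` and each component `Z` at `l`, from the
columns whose label has the component `Z` at `l` to the symbols whose label has it. -/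
abbrev Matching {m n : ℕ} (a b : Fin n → Index m) : Type :=
  (l : Finset.Icc 1 m) → (Z : components m l) →
    {k // component (a k) l = Z} ≃ {s // component (b s) l = Z}

/-- The matching induced by a linking: the row `l` of the rectangle, restricted to the columns
with a given component at `l`. -/
def IsLinking.toMatching {m n : ℕ} {a b : Fin n → Index m}
    {π : Finset.Icc 1 m → Equiv.Perm (Fin n)} (h : IsLinking a b π) : Matching a b :=
  fun l _ => (π l).subtypeEquiv fun k => by rw [h.component_eq]

/-- The symbol assigned to the column `k` at position `j` by a matching: the partner of `k` in
the component of `a k` that contains `j`. -/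
noncomputable def Matching.symbol {m n : ℕ} {a b : Fin n → Index m} (τ : Matching a b)
    (j : Finset.Icc 1 m) (k : Fin n) : Fin n :=
  (τ (root (a k) j) ⟨_, component_mem_components_iff.2 (apply_root (a k) j)⟩ ⟨k, rfl⟩).1

theorem Matching.component_symbol {m n : ℕ} {a b : Fin n → Index m} (τ : Matching a b)
    (j : Finset.Icc 1 m) (k : Fin n) :
    component (a k) (root (a k) j) = component (b (τ.symbol j k)) (root (a k) j) :=
  (τ (root (a k) j) ⟨_, component_mem_components_iff.2 (apply_root (a k) j)⟩ ⟨k, rfl⟩).2.symm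

theorem Matching.symbol_eq {m n : ℕ} {a b : Fin n → Index m} (τ : Matching a b)
    {j l : Finset.Icc 1 m} {k : Fin n} (hl : root (a k) j = l) (Z : components m l)
    (hk : component (a k) l = Z) : τ.symbol j k = (τ l Z ⟨k, hk⟩).1 := by
  subst hl
  obtain ⟨Z, hZ⟩ := Z
  revert hk
  intro (hk : component (a k) (root (a k) j) = Z)
  subst hk
  rfl

/-- The symbol determines the column: its label has the same component as the column label, hence
shows which bijection of the matching was used. -/
theorem Matching.symbol_injective {m n : ℕ} {a b : Fin n → Index m} (τ : Matching a b)
    (j : Finset.Icc 1 m) : Function.Injective (τ.symbol j) := by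
  intro k k' he
  have h1 := τ.component_symbol j k
  have h2 := τ.component_symbol j k'
  have hr : root (a k') j = root (a k) j := by
    rw [← (eq_of_component_eq h1).2, ← (eq_of_component_eq h2).2, he]
  have hZ : component (a k') (root (a k) j) = component (a k) (root (a k) j) := by
    rw [h1, he, ← hr, h2]
  have hm := component_mem_components_iff.2 (apply_root (a k) j)
  rw [τ.symbol_eq rfl ⟨_, hm⟩ rfl, τ.symbol_eq hr ⟨_, hm⟩ hZ] at he
  exact congrArg Subtype.val ((τ _ _).injective (Subtype.ext he))

/-- A linking amounts to a matching: the entries at positions that cover nothing determine all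
others, and any component-preserving choice of them extends. -/
theorem bijective_toMatching {m n : ℕ} (a b : Fin n → Index m) :
    Function.Bijective fun π : {π // IsLinking a b π} => π.2.toMatching := by
  constructor
  · rintro ⟨π, h⟩ ⟨π', h'⟩ he
    refine Subtype.ext (funext fun j => Equiv.ext fun k => ?_)
    change π j k = π' j k
    rw [apply_eq_apply_root h.1, apply_eq_apply_root h'.1]
    exact congrArg Subtype.val (DFunLike.congr_fun (congrFun (congrFun he (root (a k) j))
      ⟨_, component_mem_components_iff.2 (apply_root (a k) j)⟩) ⟨k, rfl⟩)
  · intro τ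
    let π : Finset.Icc 1 m → Equiv.Perm (Fin n) := fun j =>
      Equiv.ofBijective _ (Finite.injective_iff_bijective.1 (τ.symbol_injective j))
    have h : IsLinking a b π := by
      refine ⟨fun k j i hc => ?_, fun k j =>
        (eq_of_component_eq (τ.component_symbol j k)).1.symm⟩
      exact τ.symbol_eq (root_of_covers hc) _ rfl
    refine ⟨⟨π, h⟩, ?_⟩
    funext l Z
    refine Equiv.ext fun k => Subtype.ext ?_
    have h0 : (a k l : ℕ) = 0 := component_mem_components_iff.1 (by rw [k.2]; exact Z.2)
    exact τ.symbol_eq (LatinRect.root_eq h0 .refl) Z k.2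

/-- The number of times that `a` takes the value `α`. -/
def count {m n : ℕ} (a : Fin n → Index m) (α : Index m) : ℕ :=
  (Finset.univ.filter fun k => a k = α).card

theorem card_component_eq {m n : ℕ} (a : Fin n → Index m) (l : ℕ) (Z : Finset (ℕ × ℕ)) :
    Fintype.card {k // component (a k) l = Z} = q (count a) l Z := by
  rw [Fintype.card_subtype, q,
    Finset.card_eq_sum_card_fiberwise (f := a) (t := Q m l Z) (fun k hk => by simpa [Q] using hk)]
  refine Finset.sum_congr rfl fun α hα => ?_
  rw [count, Finset.filter_filter]
  congr 1
  ext k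
  simp only [Finset.mem_filter, Finset.mem_univ, true_and, and_iff_right_iff_imp]
  rintro rfl
  simpa [Q] using hα

open Classical in
/-- The number of linkings is a product of numbers of bijections between finite sets, one pair of
sets for each component. -/
theorem card_isLinking {m n : ℕ} (a b : Fin n → Index m) :
    Fintype.card {π // IsLinking a b π} =
      if Compatible (count a) (count b) then
        ∏ l ∈ Finset.Icc 1 m, ∏ Z ∈ components m l, (q (count a) l Z)! else 0 := by
  rw [Fintype.card_congr (Equiv.ofBijective _ (bijective_toMatching a b))]
  split_ifs with h
  · rw [Fintype.card_pi, ← Finset.prod_coe_sort (Finset.Icc 1 m)]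
    refine Finset.prod_congr rfl fun l _ => ?_
    rw [Fintype.card_pi, ← Finset.prod_coe_sort (components m l)]
    refine Finset.prod_congr rfl fun Z _ => ?_
    rw [Fintype.card_equiv (Fintype.equivOfCardEq ?_), card_component_eq]
    rw [card_component_eq, card_component_eq, h l l.2 Z Z.2]
  · rw [Fintype.card_eq_zero_iff]
    refine ⟨fun τ => h fun l hl Z hZ => ?_⟩
    rw [← card_component_eq, ← card_component_eq]
    exact (Fintype.card_congr (τ ⟨l, hl⟩ ⟨Z, hZ⟩)).symm

/-! ### Inclusion–exclusion over index sequences -/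

/-- The factors that, multiplied over the positions `j`, expand to the inclusion–exclusion over
all index sequences: choosing `t = 0` contributes `1`, choosing an earlier position `t` contributes
`-1` if `f` takes the same value there, and `0` otherwise. -/
noncomputable def linkFactor {m : ℕ} {X : Type*} (f : Finset.Icc 1 m → X) (j : Finset.Icc 1 m)
    (t : ℕ) : ℚ :=
  open Classical in
  if t = 0 then 1 else if ∀ i : Finset.Icc 1 m, t = i → f j = f i then -1 else 0

theorem linkFactor_zero {m : ℕ} {X : Type*} (f : Finset.Icc 1 m → X) (j : Finset.Icc 1 m) :
    linkFactor f j 0 = 1 := if_pos rfl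

theorem linkFactor_coe {m : ℕ} {X : Type*} [DecidableEq X] (f : Finset.Icc 1 m → X)
    (j i : Finset.Icc 1 m) : linkFactor f j i = if f j = f i then -1 else 0 := by
  have h : (i : ℕ) ≠ 0 := by have := (Finset.mem_Icc.1 i.2).1; omega
  have h' : (∀ x : Finset.Icc 1 m, (i : ℕ) = x → f j = f x) ↔ f j = f i := by
    refine ⟨fun h => h i rfl, fun h x hx => ?_⟩
    obtain rfl := Subtype.ext hx
    exact h
  simp only [linkFactor, if_neg h, h']

theorem eq_zero_or_exists_lt {m : ℕ} {j : Finset.Icc 1 m} (t : Fin (j : ℕ)) :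
    (t : ℕ) = 0 ∨ ∃ i : Finset.Icc 1 m, i < j ∧ (t : ℕ) = i := by
  by_cases h : (t : ℕ) = 0
  · exact .inl h
  · have hj := Finset.mem_Icc.1 j.2
    exact .inr ⟨⟨t, Finset.mem_Icc.2 ⟨by omega, by omega⟩⟩, t.isLt, rfl⟩

open Classical in
theorem prod_sum_linkFactor {m : ℕ} {X : Type*} (f : Finset.Icc 1 m → X)
    [Decidable (Function.Injective f)] :
    ∏ j : Finset.Icc 1 m, ∑ t : Fin (j : ℕ), linkFactor f j t =
      if Function.Injective f then 1 else 0 := by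
  have hpos (j : Finset.Icc 1 m) : 0 < (j : ℕ) := (Finset.mem_Icc.1 j.2).1
  split_ifs with h
  · refine Finset.prod_eq_one fun j _ => ?_
    rw [Fintype.sum_eq_single ⟨0, hpos j⟩, linkFactor_zero]
    intro t ht
    rcases eq_zero_or_exists_lt t with h0 | ⟨i, hi, hti⟩
    · exact absurd (Fin.ext h0) ht
    · rw [hti, linkFactor_coe, if_neg fun he => hi.ne' (h he)]
  · have hne : {j | ∃ i < j, f i = f j}.Nonempty := by
      simp only [Function.Injective, not_forall] at h
      obtain ⟨i, j, he, hij⟩ := h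
      rcases lt_or_gt_of_ne hij with hlt | hlt
      · exact ⟨j, i, hlt, he⟩
      · exact ⟨i, j, hlt, he.symm⟩
    -- At the first position `j` that repeats an earlier value, it repeats exactly one of them.
    obtain ⟨j, ⟨i, hij, he⟩, hmin⟩ := wellFounded_lt.has_min _ hne
    refine Finset.prod_eq_zero (Finset.mem_univ j) ?_
    have hi0 : (i : ℕ) ≠ 0 := (hpos i).ne'
    rw [Fintype.sum_eq_add ⟨0, hpos j⟩ ⟨i, hij⟩]
    · rw [linkFactor_zero, linkFactor_coe, if_pos he.symm]
      norm_num
    · exact fun h => hi0 (congrArg Fin.val h).symm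
    · rintro t ⟨ht0, hti⟩
      rcases eq_zero_or_exists_lt t with h0 | ⟨x, hx, htx⟩
      · exact absurd (Fin.ext h0) ht0
      · rw [htx, linkFactor_coe, if_neg]
        intro hxe
        have hxi : x ≠ i := by
          rintro rfl
          exact hti (Fin.ext htx)
        rcases lt_or_gt_of_ne hxi with hlt | hlt
        · exact hmin i ⟨x, hlt, hxe.symm.trans he.symm⟩ hij
        · exact hmin x ⟨i, hlt, he.trans hxe⟩ hx

open Classical in
theorem prod_linkFactor {m : ℕ} {X : Type*} (f : Finset.Icc 1 m → X) (α : Index m) :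
    ∏ j, linkFactor f j (α j) =
      (-1) ^ (m + zeta α) * if ∀ j i, Covers α j i → f j = f i then 1 else 0 := by
  have hsign : ∏ j, (if (α j : ℕ) = 0 then (1 : ℚ) else -1) = (-1) ^ (m + zeta α) := by
    have h (j : Finset.Icc 1 m) : (if (α j : ℕ) = 0 then (1 : ℚ) else -1) =
        -1 * if (α j : ℕ) = 0 then -1 else 1 := by split_ifs <;> norm_num
    rw [Finset.prod_congr rfl fun j _ => h j, Finset.prod_mul_distrib, Finset.prod_const,
      ← Finset.prod_filter, Finset.prod_const, pow_add, zeta]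
    simp
  split_ifs with h
  · rw [mul_one, ← hsign]
    refine Finset.prod_congr rfl fun j _ => ?_
    unfold linkFactor
    exact if_congr Iff.rfl rfl (if_pos (h j))
  · simp only [not_forall] at h
    obtain ⟨j, i, hc, hne⟩ := h
    rw [mul_zero]
    refine Finset.prod_eq_zero (Finset.mem_univ j) ?_
    rw [show (α j : ℕ) = i from hc, linkFactor_coe, if_neg hne]

open Classical in
/-- Inclusion–exclusion for injectivity, with one term for each index sequence. -/
theorem indicator_injective {m : ℕ} {X : Type*} (f : Finset.Icc 1 m → X)
    [Decidable (Function.Injective f)] :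
    (if Function.Injective f then (1 : ℚ) else 0) =
      ∑ α : Index m, (-1) ^ (m + zeta α) *
        if ∀ j i, Covers α j i → f j = f i then 1 else 0 := by
  rw [← prod_sum_linkFactor, Finset.prod_univ_sum]
  simp only [Fintype.piFinset_univ]
  exact Finset.sum_congr rfl fun α _ => prod_linkFactor f α

open Classical in
theorem indicator_covers_eq_sum {m n : ℕ} (a : Fin n → Index m)
    (π : Finset.Icc 1 m → Equiv.Perm (Fin n)) :
    (if ∀ k j i, Covers (a k) j i → π j k = π i k then (1 : ℚ) else 0) =
      ∑ b : Fin n → Index m, if IsLinking a b π then 1 else 0 := by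
  -- the symbol labels are determined by the rows and the column labels
  rw [Fintype.sum_eq_single fun s j => a ((π j).symm s) j]
  · simp [IsLinking]
  · intro b hb
    refine if_neg fun h => hb ?_
    funext s j
    have := h.2 ((π j).symm s) j
    rwa [Equiv.apply_symm_apply] at this

open Classical in
/-- The rectangles with injective columns, counted with signs through all pairs of column labels
and symbol labels. -/
theorem card_injective_columns (m n : ℕ) :
    (Fintype.card {π : Finset.Icc 1 m → Equiv.Perm (Fin n) //
        ∀ k, Function.Injective fun j => π j k} : ℚ) =
      ∑ a : Fin n → Index m, ∑ b : Fin n → Index m,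
        (-1) ^ (n * m + ∑ k, zeta (a k)) * (Fintype.card {π // IsLinking a b π} : ℚ) := by
  have hcard {X : Type} [Fintype X] (p : X → Prop) [Fintype {x // p x}] :
      (Fintype.card {x // p x} : ℚ) = ∑ x, if p x then 1 else 0 := by
    rw [Fintype.card_subtype, Finset.sum_boole]
  have hprod (p : Fin n → Prop) [Decidable (∀ k, p k)] :
      (if ∀ k, p k then (1 : ℚ) else 0) = ∏ k, if p k then 1 else 0 := by
    rw [Finset.prod_ite_zero]
    simp
  rw [hcard]
  calc _ = ∑ π : Finset.Icc 1 m → Equiv.Perm (Fin n), ∑ a : Fin n → Index m,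
        (-1 : ℚ) ^ (n * m + ∑ k, zeta (a k)) *
          if ∀ k j i, Covers (a k) j i → π j k = π i k then 1 else 0 := by
        refine Finset.sum_congr rfl fun π _ => ?_
        simp only [hprod, indicator_injective, Finset.prod_univ_sum, Fintype.piFinset_univ,
          Finset.prod_mul_distrib, Finset.prod_pow_eq_pow_sum, Finset.sum_add_distrib,
          Finset.sum_const, Finset.card_univ, Fintype.card_fin, smul_eq_mul]
        congr!
    _ = _ := by
        rw [Finset.sum_comm]
        refine Finset.sum_congr rfl fun a _ => ?_
        rw [← Finset.mul_sum, ← Finset.mul_sum]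
        congr 1
        simp only [indicator_covers_eq_sum, hcard]
        exact Finset.sum_comm

/-! ### Sequences and their multiplicities -/

theorem monomial_eq_prod {ι : Type*} [Fintype ι] (k : ι → ℕ) :
    ∏ i, (MvPolynomial.X i : MvPolynomial ι ℚ) ^ k i =
      MvPolynomial.monomial (Finsupp.equivFunOnFinite.symm k) 1 := by
  rw [MvPolynomial.monomial_eq, Finsupp.prod_fintype _ _ fun i => pow_zero _]
  simp

/-- A sum over sequences of a function of the multiplicities only: each family of multiplicities
occurs multinomially often. -/
theorem sum_count {m n : ℕ} (F : (Index m → ℕ) → ℚ) :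
    ∑ a : Fin n → Index m, F (count a) =
      ∑ r ∈ Finset.piAntidiag Finset.univ n, (Nat.multinomial Finset.univ r : ℚ) * F r := by
  -- apply the linear form `monomial r ↦ F r` to both expansions of `(∑ X α) ^ n`
  let ev := (MvPolynomial.basisMonomials (Index m) ℚ).constr ℚ fun r => F r
  have hev (r : Index m → ℕ) : ev (∏ α, MvPolynomial.X α ^ r α) = F r := by
    rw [monomial_eq_prod, ← congrFun (MvPolynomial.coe_basisMonomials _ ℚ),
      Module.Basis.constr_basis]
    rfl
  have h1 := congrArg ev (Fintype.sum_pow (fun α : Index m => (MvPolynomial.X α :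
    MvPolynomial (Index m) ℚ)) n)
  rw [Finset.sum_pow_eq_sum_piAntidiag, map_sum, map_sum] at h1
  have h2 (a : Fin n → Index m) :
      ev (∏ k, MvPolynomial.X (a k)) = F (count a) := by
    rw [← hev, ← Finset.prod_fiberwise' Finset.univ a]
    simp only [Finset.prod_const, count]
  rw [Finset.sum_congr rfl fun a _ => (h2 a).symm, ← h1]
  refine Finset.sum_congr rfl fun r _ => ?_
  rw [← nsmul_eq_mul, map_nsmul, hev, nsmul_eq_mul]

/-! ### Reduced Latin rectangles -/

/-- A Latin rectangle is a reduced one with its symbols permuted; the permutation is the first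
row. -/
noncomputable def reducedProdPermEquiv {m n : ℕ} (hm : 1 ≤ m) :
    {M : Matrix (Fin m) (Fin n) (Fin n) // IsLatinRectangle M ∧ IsReduced M} ×
        Equiv.Perm (Fin n) ≃
      {π : Finset.Icc 1 m → Equiv.Perm (Fin n) // ∀ k, Function.Injective fun j => π j k} :=
  Equiv.ofBijective
    (fun x => ⟨fun j => (Equiv.ofBijective _ (Finite.injective_iff_bijective.1
        (x.1.2.1.1 ⟨j - 1, by have := Finset.mem_Icc.1 j.2; omega⟩))).trans x.2, by
      intro k i j h
      have h' := congrArg Fin.val (x.1.2.1.2 k (x.2.injective h))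
      have hi := Finset.mem_Icc.1 i.2
      have hj := Finset.mem_Icc.1 j.2
      exact Subtype.ext (by simp only at h'; omega)⟩)
    (by
      constructor
      · rintro ⟨⟨M, hM, hr⟩, σ⟩ ⟨⟨M', hM', hr'⟩, σ'⟩ h
        have h1 (j : Finset.Icc 1 m) (k : Fin n) (hj : (j : ℕ) - 1 < m) :
            σ (M ⟨j - 1, hj⟩ k) = σ' (M' ⟨j - 1, hj⟩ k) :=
          DFunLike.congr_fun (congrFun (congrArg Subtype.val h) j) k
        have hσ : σ = σ' := by
          ext k : 1
          have := h1 ⟨1, Finset.mem_Icc.2 ⟨le_rfl, hm⟩⟩ k (by simp; omega)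
          rwa [hr _ rfl, hr' _ rfl] at this
        subst hσ
        have hMM : M = M' := by
          funext i k
          exact σ.injective (h1 ⟨i + 1, Finset.mem_Icc.2 ⟨by omega, i.isLt⟩⟩ k (by simp))
        subst hMM
        rfl
      · rintro ⟨π, hπ⟩
        let p (i : Fin m) : Finset.Icc 1 m := ⟨i + 1, Finset.mem_Icc.2 ⟨by omega, i.isLt⟩⟩
        let σ := π (p ⟨0, hm⟩)
        refine ⟨⟨⟨fun i k => σ.symm (π (p i) k), ⟨fun i => ?_, fun k i j h => ?_⟩, ?_⟩, σ⟩, ?_⟩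
        · exact σ.symm.injective.comp (π (p i)).injective
        · have h' := congrArg Subtype.val (hπ k (σ.symm.injective h))
          exact Fin.ext (Nat.add_right_cancel h')
        · intro i hi k
          obtain rfl : i = ⟨0, hm⟩ := Fin.ext hi
          exact σ.symm_apply_apply k
        · refine Subtype.ext (funext fun j => Equiv.ext fun k => ?_)
          refine (σ.apply_symm_apply _).trans ?_
          have hj : p ⟨j - 1, by have := Finset.mem_Icc.1 j.2; omega⟩ = j :=
            Subtype.ext (Nat.sub_add_cancel (Finset.mem_Icc.1 j.2).1)
          rw [hj])

/-! ### Sums and products over components -/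

theorem card_index (m : ℕ) : Fintype.card (Index m) = m ! := by
  rw [Fintype.card_pi, ← Finset.prod_Ico_id_eq_factorial, Finset.Ico_add_one_right_eq_Icc,
    ← Finset.prod_coe_sort (Finset.Icc 1 m)]
  simp

theorem disjoint_Q {m l : ℕ} {Z Z' : Finset (ℕ × ℕ)} (h : Z ≠ Z') :
    Disjoint (Q m l Z) (Q m l Z') := by
  rw [Finset.disjoint_left]
  intro α h1 h2
  exact h ((Finset.mem_filter.1 h1).2.symm.trans (Finset.mem_filter.1 h2).2)

theorem biUnion_Q {m : ℕ} (l : Finset.Icc 1 m) :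
    (components m l).biUnion (Q m l) = Finset.univ.filter fun α => (α l : ℕ) = 0 := by
  ext α
  simp [Q, ← component_mem_components_iff]

theorem prod_components {m : ℕ} {M : Type*} [CommMonoid M] (l : Finset.Icc 1 m)
    (f : Index m → M) :
    ∏ Z ∈ components m l, ∏ α ∈ Q m l Z, f α =
      ∏ α, if (α l : ℕ) = 0 then f α else 1 := by
  rw [← Finset.prod_biUnion fun _ _ _ _ h => disjoint_Q h, biUnion_Q, Finset.prod_filter]

/-- The index `α` has `ζ(α)` nonempty components, so that a product over all components meets
each of its factors `ζ(α)` times. -/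
theorem prod_prod_components {m : ℕ} {M : Type*} [CommMonoid M] (f : Index m → M) :
    ∏ l ∈ Finset.Icc 1 m, ∏ Z ∈ components m l, ∏ α ∈ Q m l Z, f α = ∏ α, f α ^ zeta α := by
  rw [← Finset.prod_coe_sort (Finset.Icc 1 m), Finset.prod_congr rfl fun l _ => prod_components l f,
    Finset.prod_comm]
  refine Finset.prod_congr rfl fun α _ => ?_
  rw [← Finset.prod_filter, Finset.prod_const, zeta]

theorem sum_sum_q {m : ℕ} (r : Index m → ℕ) :
    ∑ l ∈ Finset.Icc 1 m, ∑ Z ∈ components m l, q r l Z = ∑ α, r α * zeta α := by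
  have h := prod_prod_components fun α => Multiplicative.ofAdd (r α)
  apply_fun Multiplicative.toAdd at h
  simpa [q, mul_comm] using h

theorem apply_one {m : ℕ} (hm : 1 ∈ Finset.Icc 1 m) (α : Index m) : (α ⟨1, hm⟩ : ℕ) = 0 :=
  Nat.lt_one_iff.1 (α ⟨1, hm⟩).isLt

theorem prod_components_one {m : ℕ} (hm : 1 ≤ m) {M : Type*} [CommMonoid M] (f : Index m → M) :
    ∏ Z ∈ components m 1, ∏ α ∈ Q m 1 Z, f α = ∏ α, f α := by
  have h1 : 1 ∈ Finset.Icc 1 m := Finset.mem_Icc.2 ⟨le_rfl, hm⟩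
  refine (prod_components ⟨1, h1⟩ f).trans (Finset.prod_congr rfl fun α _ => ?_)
  rw [if_pos (apply_one h1 α)]

theorem sum_components_one {m : ℕ} (hm : 1 ≤ m) (r : Index m → ℕ) :
    ∑ Z ∈ components m 1, q r 1 Z = ∑ α, r α := by
  have h := prod_components_one hm fun α => Multiplicative.ofAdd (r α)
  apply_fun Multiplicative.toAdd at h
  simpa [q] using h

theorem one_le_zeta {m : ℕ} (hm : 1 ≤ m) (α : Index m) : 1 ≤ zeta α := by
  have h1 : 1 ∈ Finset.Icc 1 m := Finset.mem_Icc.2 ⟨le_rfl, hm⟩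
  exact Finset.card_pos.2 ⟨⟨1, h1⟩, Finset.mem_filter.2 ⟨Finset.mem_univ _, apply_one h1 α⟩⟩

theorem q_zero {m : ℕ} (r : Index m → ℕ) : q r 0 ∅ = ∑ α, r α := by
  have h (α : Index m) : component α 0 = ∅ := by
    simp only [component, Finset.image_eq_empty, Finset.filter_eq_empty_iff]
    rintro j - ⟨i, hi, -⟩
    have := (Finset.mem_Icc.1 i.2).1
    omega
  simp [q, Q, h]

theorem prod_Icc_zero {m : ℕ} (f : ℕ → Finset (ℕ × ℕ) → ℚ) :
    ∏ l ∈ Finset.Icc 0 m, ∏ Z ∈ components m l, f l Z =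
      f 0 ∅ * ∏ l ∈ Finset.Icc 1 m, ∏ Z ∈ components m l, f l Z := by
  rw [← Finset.insert_Icc_succ_left_eq_Icc (Nat.zero_le m), Finset.prod_insert (by simp)]
  simp [components]

theorem prod_Icc_one {m : ℕ} (hm : 1 ≤ m) (f : ℕ → ℚ) :
    ∏ l ∈ Finset.Icc 1 m, f l = f 1 * ∏ l ∈ Finset.Icc 2 m, f l := by
  rw [← Finset.insert_Icc_succ_left_eq_Icc hm, Finset.prod_insert (by simp)]
  rfl

theorem Compatible.sum_eq {m : ℕ} (hm : 1 ≤ m) {r c : Index m → ℕ} (h : Compatible r c) :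
    ∑ α, c α = ∑ α, r α := by
  rw [← sum_components_one hm, ← sum_components_one hm]
  exact Finset.sum_congr rfl fun Z hZ => h 1 (Finset.mem_Icc.2 ⟨le_rfl, hm⟩) Z hZ

theorem cast_multinomial {ι : Type*} (s : Finset ι) (x : ι → ℕ) :
    (Nat.multinomial s x : ℚ) = (∑ i ∈ s, x i)! / ∏ i ∈ s, ((x i)! : ℚ) := by
  rw [eq_div_iff (Finset.prod_ne_zero_iff.2 fun i _ => by positivity), mul_comm]
  exact_mod_cast Nat.multinomial_spec s x

theorem neg_one_pow_sumW {m : ℕ} (r : Index m → ℕ) :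
    (-1 : ℚ) ^ sumW r = (-1) ^ ∑ α, r α * zeta α := by
  rw [sumW, ← Finset.prod_pow_eq_pow_sum, ← Finset.prod_pow_eq_pow_sum, Finset.prod_filter]
  refine Finset.prod_congr rfl fun α _ => ?_
  rw [mul_comm, pow_mul]
  split_ifs with h
  · rw [h.neg_one_pow]
  · rw [(Nat.not_odd_iff_even.1 h).neg_one_pow, one_pow]

theorem raisingFactorial_neg (k : ℕ) : raisingFactorial (-(k : ℤ)) = (-1) ^ k * k ! := by
  have h (i : ℕ) (hi : i ∈ Finset.range k) : -(k : ℤ) + i = -1 * ((k - i : ℕ) : ℤ) := by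
    rw [Nat.cast_sub (Finset.mem_range.1 hi).le]
    ring
  rw [raisingFactorial, raising, Int.natAbs_neg, Int.natAbs_natCast, Finset.prod_congr rfl h,
    Finset.prod_mul_distrib, Finset.prod_const, Finset.card_range, ← Nat.cast_prod]
  congr 2
  rw [← Nat.descFactorial_self, Nat.descFactorial_eq_prod_range]

theorem sum_count_mul {m n : ℕ} (a : Fin n → Index m) (f : Index m → ℕ) :
    ∑ α, count a α * f α = ∑ k, f (a k) := by
  rw [← Finset.sum_fiberwise' Finset.univ a]
  simp [count]

/-! ### The common value of the four sums -/

open Classical in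
/-- The compatible pairs `(r, c)` of families with sum `n`: the possible multiplicities of the
column labels and of the symbol labels of a rectangle. -/
noncomputable def pairs (m n : ℕ) : Finset ((Index m → ℕ) × (Index m → ℕ)) :=
  (Finset.piAntidiag Finset.univ n ×ˢ Finset.piAntidiag Finset.univ n).filter
    fun x => Compatible x.1 x.2

theorem mem_pairs {m n : ℕ} (hm : 1 ≤ m) {x : (Index m → ℕ) × (Index m → ℕ)} :
    x ∈ pairs m n ↔ ∑ α, x.1 α = n ∧ Compatible x.1 x.2 := by
  simp only [pairs, Finset.mem_filter, Finset.mem_product, Finset.mem_piAntidiag]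
  constructor
  · exact fun h => ⟨h.1.1.1, h.2⟩
  · exact fun h => ⟨⟨⟨h.1, by simp⟩, (h.2.sum_eq hm).trans h.1, by simp⟩, h.2⟩

/-- The contribution of a pair of multiplicities to the number of reduced Latin rectangles. -/
noncomputable def contribution {m : ℕ} (n : ℕ) (r c : Index m → ℕ) : ℚ :=
  (-1) ^ (n * m + ∑ α, r α * zeta α) * Nat.multinomial Finset.univ r *
    (∏ l ∈ Finset.Icc 1 m, ∏ Z ∈ components m l, ((q r l Z)! : ℚ)) / ∏ β, ((c β)! : ℚ)

/-- The column labels `a` come from inclusion–exclusion, the symbol labels `b` from sorting the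
rows by the label they induce; grouping both by multiplicities gives two multinomial coefficients.
Of the second one, the numerator `n!` is the number of first rows. -/
theorem K_eq_sum_contribution {m n : ℕ} (hm : 1 ≤ m) :
    (K m n : ℚ) = ∑ x ∈ pairs m n, contribution n x.1 x.2 := by
  classical
  have hn : ((n ! : ℕ) : ℚ) ≠ 0 := by positivity
  refine mul_right_cancel₀ hn ?_
  have hK : (K m n : ℚ) * n ! = (Fintype.card {π : Finset.Icc 1 m → Equiv.Perm (Fin n) //
      ∀ k, Function.Injective fun j => π j k} : ℚ) := by
    rw [← Nat.card_eq_fintype_card, ← Nat.card_congr (reducedProdPermEquiv hm), Nat.card_prod,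
      Nat.card_eq_fintype_card (α := Equiv.Perm _), Fintype.card_perm, Fintype.card_fin, K]
    push_cast
    rfl
  let G (r c : Index m → ℕ) : ℚ := (-1) ^ (n * m + ∑ α, r α * zeta α) *
    if Compatible r c then ∏ l ∈ Finset.Icc 1 m, ∏ Z ∈ components m l, ((q r l Z)! : ℚ) else 0
  have hG (a b : Fin n → Index m) : (-1) ^ (n * m + ∑ k, zeta (a k)) *
      (Fintype.card {π // IsLinking a b π} : ℚ) = G (count a) (count b) := by
    simp only [G, sum_count_mul, card_isLinking]
    push_cast
    rfl
  simp only [hK, card_injective_columns, hG]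
  rw [Finset.sum_congr rfl fun a _ => sum_count (G (count a)),
    sum_count fun r => ∑ c ∈ Finset.piAntidiag Finset.univ n,
      (Nat.multinomial Finset.univ c : ℚ) * G r c, pairs, Finset.sum_filter,
    Finset.sum_product, Finset.sum_mul]
  refine Finset.sum_congr rfl fun r _ => ?_
  rw [Finset.mul_sum, Finset.sum_mul]
  refine Finset.sum_congr rfl fun c hc => ?_
  simp only [G, contribution]
  split_ifs
  · rw [cast_multinomial _ c, (Finset.mem_piAntidiag.1 hc).1]
    ring
  · ring

/-- In the ranges of summation only the finitely many pairs in `pairs m n` contribute. -/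
theorem finsum_mem_eq_sum_pairs {m n : ℕ} {s : Set ((Index m → ℕ) × (Index m → ℕ))}
    {f : (Index m → ℕ) × (Index m → ℕ) → ℚ} (hs : ↑(pairs m n) ⊆ s)
    (h0 : ∀ x ∈ s, x ∉ pairs m n → f x = 0) : ∑ᶠ x ∈ s, f x = ∑ x ∈ pairs m n, f x := by
  refine finsum_mem_eq_sum_of_inter_support_eq f (Set.ext fun x => ?_)
  refine and_congr_left fun hx => ⟨fun h => ?_, fun h => hs h⟩
  by_contra hn
  exact hx (h0 x h hn)

end LatinRect

open LatinRect

theorem theorem5p1 (m n : ℕ) (hm : 1 ≤ m) (hmn : m ≤ n) :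
    -- the index set has `m!` elements, so that there are `2 · m!` variables `(r, c)`
    Fintype.card (LatinRect.Index m) = m ! ∧
    -- first expression
    (LatinRect.K m n : ℚ) =
      ∑ᶠ x ∈ {x : (LatinRect.Index m → ℕ) × (LatinRect.Index m → ℕ) |
          LatinRect.Compatible x.1 x.2},
        (-1 : ℚ) ^ (n * m + ∑ l ∈ Finset.Icc 1 m, ∑ Z ∈ LatinRect.components m l,
            LatinRect.q x.1 l Z)
          * (LatinRect.multinom n Finset.univ x.1 : ℚ)
          * (∏ l ∈ Finset.Icc 2 m, ∏ Z ∈ LatinRect.components m l,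
              ((LatinRect.q x.1 l Z)! : ℚ))
          * ∏ Z ∈ LatinRect.components m 1,
              (LatinRect.multinom (LatinRect.q x.1 1 Z) (LatinRect.Q m 1 Z) x.2 : ℚ) ∧
    -- second expression
    (LatinRect.K m n : ℚ) =
      ∑ᶠ x ∈ {x : (LatinRect.Index m → ℕ) × (LatinRect.Index m → ℕ) |
          ∑ α, x.1 α = n ∧ LatinRect.Compatible x.1 x.2},
        (-1 : ℚ) ^ (n * m + LatinRect.sumW x.1)
          * ((∏ l ∈ Finset.Icc 0 m, ∏ Z ∈ LatinRect.components m l,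
              ((LatinRect.q x.1 l Z)! : ℚ))
            / ((∏ α, ((x.1 α)! : ℚ)) * ∏ β, ((x.2 β)! : ℚ))) ∧
    -- third expression
    (LatinRect.K m n : ℚ) =
      (-1 : ℚ) ^ (n * (m - 1)) *
        ∑ᶠ x ∈ {x : (LatinRect.Index m → ℕ) × (LatinRect.Index m → ℕ) |
            ∑ α, x.1 α = n ∧ LatinRect.Compatible x.1 x.2},
          (∏ l ∈ Finset.Icc 0 m, ∏ Z ∈ LatinRect.components m l,
              (LatinRect.raisingFactorial (-(LatinRect.q x.1 l Z : ℤ)) : ℚ))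
            / ((∏ α, ((x.1 α)! : ℚ)) * ∏ β, ((x.2 β)! : ℚ)) ∧
    -- fourth expression, with unrestricted variables
    (LatinRect.K m n : ℚ) =
      (-1 : ℚ) ^ (n * m) *
        ∑ᶠ x : (LatinRect.Index m → ℕ) × (LatinRect.Index m → ℕ),
          (LatinRect.multinom n Finset.univ x.1 : ℚ)
            * (∏ l ∈ Finset.Icc 1 m, ∏ Z ∈ LatinRect.components m l,
                (-1 : ℚ) ^ (LatinRect.q x.1 l Z)
                  * (LatinRect.multinom (LatinRect.q x.1 l Z) (LatinRect.Q m l Z) x.2 : ℚ))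
            * ∏ β, ((x.2 β)! : ℚ) ^ (LatinRect.zeta β - 1) := by
  have hdiv (x : (Index m → ℕ) × (Index m → ℕ)) (hx : x ∈ pairs m n) :
      contribution n x.1 x.2 = (-1) ^ (n * m + ∑ α, x.1 α * zeta α) *
        ((n ! * ∏ l ∈ Finset.Icc 1 m, ∏ Z ∈ components m l, ((q x.1 l Z)! : ℚ)) /
          ((∏ α, ((x.1 α)! : ℚ)) * ∏ β, ((x.2 β)! : ℚ))) := by
    rw [contribution, cast_multinomial, ((mem_pairs hm).1 hx).1]
    ring
  have hset : {x : (Index m → ℕ) × (Index m → ℕ) | ∑ α, x.1 α = n ∧ Compatible x.1 x.2} =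
      ↑(pairs m n) := Set.ext fun x => (mem_pairs hm).symm
  refine ⟨card_index m, ?_, ?_, ?_, ?_⟩
  · rw [finsum_mem_eq_sum_pairs (n := n), K_eq_sum_contribution hm]
    · refine Finset.sum_congr rfl fun x hx => ?_
      obtain ⟨hn, hc⟩ := (mem_pairs hm).1 hx
      have h1 : ∏ Z ∈ components m 1, (multinom (q x.1 1 Z) (Q m 1 Z) x.2 : ℚ) =
          (∏ Z ∈ components m 1, ((q x.1 1 Z)! : ℚ)) / ∏ β, ((x.2 β)! : ℚ) := by
        rw [← prod_components_one hm, ← Finset.prod_div_distrib]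
        refine Finset.prod_congr rfl fun Z hZ => ?_
        have hq : ∑ α ∈ Q m 1 Z, x.2 α = q x.1 1 Z :=
          hc 1 (Finset.mem_Icc.2 ⟨le_rfl, hm⟩) Z hZ
        rw [multinom, if_pos hq, cast_multinomial, hq]
      rw [h1, sum_sum_q, multinom, if_pos hn, contribution, prod_Icc_one hm]
      ring
    · exact fun x hx => ((mem_pairs hm).1 hx).2
    · intro x hc hx
      have hn : ∑ α, x.1 α ≠ n := fun hn => hx ((mem_pairs hm).2 ⟨hn, hc⟩)
      simp [multinom, hn]
  · rw [hset, finsum_mem_coe_finset, K_eq_sum_contribution hm]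
    refine Finset.sum_congr rfl fun x hx => ?_
    rw [hdiv x hx, prod_Icc_zero fun l Z => ((q x.1 l Z)! : ℚ), q_zero,
      ((mem_pairs hm).1 hx).1, pow_add, pow_add, neg_one_pow_sumW]
  · rw [hset, finsum_mem_coe_finset, K_eq_sum_contribution hm, Finset.mul_sum]
    refine Finset.sum_congr rfl fun x hx => ?_
    -- the factor with `l = 0` contributes the sign `(-1) ^ n`
    have hs : (-1 : ℚ) ^ (n * m) = (-1) ^ (n * (m - 1)) * (-1) ^ n := by
      rw [← pow_add, ← Nat.mul_succ, Nat.succ_eq_add_one, Nat.sub_add_cancel hm]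
    simp only [raisingFactorial_neg]
    push_cast
    rw [hdiv x hx, prod_Icc_zero fun l Z => (-1 : ℚ) ^ q x.1 l Z * ((q x.1 l Z)! : ℚ), q_zero,
      ((mem_pairs hm).1 hx).1, pow_add, hs, ← sum_sum_q]
    simp only [Finset.prod_mul_distrib, Finset.prod_pow_eq_pow_sum]
    ring
  · rw [← finsum_mem_univ, finsum_mem_eq_sum_pairs (n := n) (Set.subset_univ _),
      K_eq_sum_contribution hm, Finset.mul_sum]
    · refine Finset.sum_congr rfl fun x hx => ?_
      obtain ⟨hn, hc⟩ := (mem_pairs hm).1 hx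
      have h1 : ∏ l ∈ Finset.Icc 1 m, ∏ Z ∈ components m l,
          ((-1 : ℚ) ^ q x.1 l Z * (multinom (q x.1 l Z) (Q m l Z) x.2 : ℚ)) =
          (-1) ^ (∑ α, x.1 α * zeta α) *
            ((∏ l ∈ Finset.Icc 1 m, ∏ Z ∈ components m l, ((q x.1 l Z)! : ℚ)) /
              ∏ β, ((x.2 β)! : ℚ) ^ zeta β) := by
        rw [← prod_prod_components, ← sum_sum_q, ← Finset.prod_div_distrib]
        simp only [Finset.prod_mul_distrib, Finset.prod_pow_eq_pow_sum]
        congr 1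
        refine Finset.prod_congr rfl fun l hl => ?_
        rw [← Finset.prod_div_distrib]
        refine Finset.prod_congr rfl fun Z hZ => ?_
        have hq : ∑ α ∈ Q m l Z, x.2 α = q x.1 l Z := hc l hl Z hZ
        rw [multinom, if_pos hq, cast_multinomial, hq]
      have h2 : ∏ β, ((x.2 β)! : ℚ) ^ zeta β =
          (∏ β, ((x.2 β)! : ℚ)) * ∏ β, ((x.2 β)! : ℚ) ^ (zeta β - 1) := by
        rw [← Finset.prod_mul_distrib]
        refine Finset.prod_congr rfl fun β _ => ?_
        rw [← pow_succ', Nat.sub_add_cancel (one_le_zeta hm β)]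
      have h3 : ∏ β, ((x.2 β)! : ℚ) ^ (zeta β - 1) ≠ 0 :=
        Finset.prod_ne_zero_iff.2 fun β _ => by positivity
      have h4 : ∏ β, ((x.2 β)! : ℚ) ≠ 0 := Finset.prod_ne_zero_iff.2 fun β _ => by positivity
      rw [h1, h2, multinom, if_pos hn, contribution, pow_add]
      field_simp
    · rintro x - hx
      by_cases hn : ∑ α, x.1 α = n
      · have hc : ¬ Compatible x.1 x.2 := fun hc => hx ((mem_pairs hm).2 ⟨hn, hc⟩)
        simp only [Compatible, not_forall] at hc
        obtain ⟨l, hl, Z, hZ, hq⟩ := hc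
        have h0 : (-1 : ℚ) ^ q x.1 l Z * (multinom (q x.1 l Z) (Q m l Z) x.2 : ℚ) = 0 := by
          rw [multinom, if_neg (id hq : ¬ ∑ α ∈ Q m l Z, x.2 α = q x.1 l Z), Nat.cast_zero,
            mul_zero]
        -- the multinomial coefficient vanishes where the restriction on `C` fails
        rw [Finset.prod_eq_zero hl (Finset.prod_eq_zero hZ h0), mul_zero, zero_mul]
      · simp [multinom, hn]
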